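/- For $L\ge 1$ and $r>0$ consider the open totally asymmetric simple exclusion process on the $2L$ sites $-L+1,\dots,L$, with a blockage of rate $r$ on the middle bond and boundary rates $\alpha=\beta=1$: particles enter at site $-L+1$ when it is vacant at rate $1$, leave from site $L$ when it is occupied at rate $1$, and a particle at site $i$ jumps to site $i+1$, if that site is vacant, at rate $1$ for $i\neq 0$ and at rate $r$ for $i=0$. This continuous-time Markov chain on $\{0,1\}^{2L}$ has a unique stationary distribution; let $$J_L(r)=r\,\Pr\big(\eta(0)=1,\ \eta(1)=0\big)$$ be its stationary current. Then for all $1\le L_1\le L_2$, $$J_{L_2}(r)=J_{L_1}(r)+O\big(r^{L_1+2}\big)\qquad\text{as } r\downarrow 0,$$ where the implied constant may depend on $L_1$ and $L_2$. Moreover, for every $L\ge1$ there are real coefficients $c_{L,k}$, $k\ge 0$, with $J_L(r)=\sum_{k\ge0}c_{L,k}r^k$ for all sufficiently small $r>0$, and $c_{L_2,k}=c_{L_1,k}$ whenever $1\le L_1\le L_2$ and $k\le L_1+1$. That is, the Taylor coefficients of the current up to order $L_1+1$ stabilise once there are at least $L_1$ sites on each side of the blockage. -/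

import Mathlib

open Filter Topology Asymptotics

/-- Sites `-m+1, …, n` of an open chain: `m` sites to the left and `n` sites to the right of the
bond between the sites `0` and `1`, which carries the blockage. -/
abbrev TasepSite (m n : ℕ) : Type := ↥(Finset.Ioc (-(m : ℤ)) (n : ℤ))

/-- Configurations: `η k = true` means that the site `k` is occupied. -/
abbrev TasepConfig (m n : ℕ) : Type := TasepSite m n → Bool

/-- The configuration after an attempted jump from site `i` to site `j`. -/
def TasepConfig.jump {m n : ℕ} (η : TasepConfig m n) (i j : TasepSite m n) : TasepConfig m n :=
  fun k => if k = j ∧ η i = true then true else if k = i ∧ η j = false then false else η k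

/-- The configuration after the occupation of the site with label `i` has been set to `v`. -/
def TasepConfig.setSite {m n : ℕ} (η : TasepConfig m n) (i : ℤ) (v : Bool) : TasepConfig m n :=
  fun k => if (k : ℤ) = i then v else η k

/-- The generator of the open TASEP on the sites `-m+1, …, n`: particles enter at the leftmost
site at rate `α`, leave from the rightmost site at rate `β`, and attempt jumps from a site `i` to
`i + 1` at rate `r` for the bond from `0` to `1` and at rate `1` for all other bonds. -/
noncomputable def tasepGenerator (m n : ℕ) (r α β : ℝ) (f : TasepConfig m n → ℝ)
    (η : TasepConfig m n) : ℝ :=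
  α * (f (η.setSite (-(m : ℤ) + 1) true) - f η)
    + (∑ i : TasepSite m n, ∑ j : TasepSite m n,
        if (i : ℤ) + 1 = j then
          (if (i : ℤ) = 0 then r else 1) * (f (η.jump i j) - f η)
        else 0)
    + β * (f (η.setSite (n : ℤ) false) - f η)

/-- `μ` is a stationary probability vector: `⟨𝓛 f⟩ = 0` for every function `f` of the
configuration. -/
def IsTasepStationary (m n : ℕ) (r α β : ℝ) (μ : TasepConfig m n → ℝ) : Prop :=
  μ ∈ stdSimplex ℝ (TasepConfig m n) ∧
    ∀ f : TasepConfig m n → ℝ, ∑ η, μ η * tasepGenerator m n r α β f η = 0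

/-- The site `0` is occupied and the site `1` is vacant. -/
def TasepConfig.CanCross {m n : ℕ} (η : TasepConfig m n) : Prop :=
  ∃ i j : TasepSite m n, (i : ℤ) = 0 ∧ (j : ℤ) = 1 ∧ η i = true ∧ η j = false

/-- The stationary state (the stationary probability vector, whenever there is exactly one). -/
noncomputable def tasepState (m n : ℕ) (r α β : ℝ) : TasepConfig m n → ℝ :=
  Classical.epsilon (IsTasepStationary m n r α β)

open Classical in
/-- The stationary current, `r` times the stationary probability that the site `0` is occupied
and the site `1` is vacant. -/
noncomputable def tasepCurrent (m n : ℕ) (r α β : ℝ) : ℝ :=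
  r * ∑ η : TasepConfig m n, if η.CanCross then tasepState m n r α β η else 0

/-- `J_L(r)`: the stationary current of the chain with `2 * L` sites and `α = β = 1`. -/
noncomputable def blockageCurrent (L : ℕ) (r : ℝ) : ℝ := tasepCurrent L L r 1 1

/-! Both chains are driven by the same events, with a full reservoir on the left and an empty one on
the right (`pairEvent`). At `r = 0` the pair drains to the step configuration, so with small `r`
each crossing of the blockage is a rare event, and a state that needs more than `k` crossings has
probability `O(r ^ (k + 1))` (`DrainsTo.exists_prob_bound`).

The chains differ first near site `-L` or its mirror image, where the short chain meets its
reservoir. Left of the blockage, a discrepancy at `x` moves right only by exchange with a vacancy of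
the short chain, and vacancies come from crossings. Hence `x + L + 1 + holes z x` is bounded by the
number of crossings (`LeftOrder`), and a discrepancy at `0` costs `L + 1` of them. The right side
follows by particle-hole reflection. So the crossing indicators differ with probability `O(r ^ (L +
1))`, and the factor `r` in the current gives the order `L + 2`.

For the Taylor series, adding `f b` to the generator makes it invertible even at `r = 0`. The
stationary expectation of `g` is the value at `b` of the inverse applied to `g`, hence analytic in
`r`. -/

/-- The generator of the chain in which the event `i ∈ I` turns the state `s` into `T i s`, at rate
`r` for `i = 0` and at rate `1` otherwise. -/
def eventGenerator {S : Type*} (I : Finset ℤ) (T : ℤ → S → S) (r : ℝ) (f : S → ℝ) (s : S) : ℝ :=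
  ∑ i ∈ I, (if i = 0 then r else 1) * (f (T i s) - f s)

/-- `μ` is a probability vector that annihilates the range of `G`. -/
def IsInvariantState {S : Type*} [Fintype S] (G : (S → ℝ) → S → ℝ) (μ : S → ℝ) : Prop :=
  μ ∈ stdSimplex ℝ S ∧ ∀ f : S → ℝ, ∑ s, μ s * G f s = 0

/-- `V` does not increase under the events `i ≠ 0`, and one of them lowers it by at least `1`
unless the state is `b`. -/
structure DrainsTo {S : Type*} (I : Finset ℤ) (T : ℤ → S → S) (V : S → ℝ) (b : S) : Prop where
  le : ∀ i ∈ I, i ≠ 0 → ∀ s, V (T i s) ≤ V s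
  drop : ∀ s, s ≠ b → ∃ i ∈ I, i ≠ 0 ∧ V (T i s) ≤ V s - 1

/-! ### Finite chains that drain to a base state: invariant states, analyticity, rare events. -/

section Chain

variable {S : Type*} {I : Finset ℤ} {T : ℤ → S → S} {r : ℝ}

theorem eventGenerator_neg (f : S → ℝ) (s : S) :
    eventGenerator I T r (-f) s = -eventGenerator I T r f s := by
  simp only [eventGenerator, ← Finset.sum_neg_distrib, Pi.neg_apply]
  exact Finset.sum_congr rfl fun i _ => by ring

theorem eventGenerator_nonpos (hr : 0 ≤ r) {f : S → ℝ} {s : S} (h : ∀ t, f t ≤ f s) :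
    eventGenerator I T r f s ≤ 0 := by
  refine Finset.sum_nonpos fun i _ => mul_nonpos_of_nonneg_of_nonpos ?_ (by linarith [h (T i s)])
  split_ifs <;> simp [hr]

variable [Fintype S] {V : S → ℝ} {b : S}

/-- A maximum principle: at a maximiser of `f` with least `V`, every event of positive rate leads to
another maximiser, so no event `i ≠ 0` can lower `V` and the state is `b`. The slow event is not
used, so `r = 0` is allowed. -/
theorem DrainsTo.le_base_of_nonneg (hV : DrainsTo I T V b) (hr : 0 ≤ r) {f : S → ℝ}
    (h : ∀ s, 0 ≤ eventGenerator I T r f s) (t : S) : f t ≤ f b := by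
  classical
  have : Nonempty S := ⟨b⟩
  obtain ⟨m, hm⟩ := Finite.exists_max f
  obtain ⟨s, hs, hmin⟩ := Finset.exists_min_image (Finset.univ.filter fun s => f s = f m) V
    ⟨m, by simp⟩
  simp only [Finset.mem_filter, Finset.mem_univ, true_and] at hs hmin
  suffices s = b by rw [← this, hs]; exact hm t
  by_contra hsb
  obtain ⟨i, hi, hi0, hlt⟩ := hV.drop s hsb
  have hterm : ∀ j ∈ I, (if j = 0 then r else 1) * (f (T j s) - f s) ≤ 0 := fun j _ =>
    mul_nonpos_of_nonneg_of_nonpos (by split_ifs <;> simp [hr]) (by linarith [hm (T j s)])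
  have hz := (Finset.sum_eq_zero_iff_of_nonpos hterm).1
    (le_antisymm (Finset.sum_nonpos hterm) (h s)) i hi
  rw [if_neg hi0, one_mul] at hz
  linarith [hmin (T i s) (by linarith)]

/-- The map `f ↦ G f + f b`. -/
def anchoredGenerator (I : Finset ℤ) (T : ℤ → S → S) (b : S) (r : ℝ) : (S → ℝ) →ₗ[ℝ] (S → ℝ) where
  toFun f s := eventGenerator I T r f s + f b
  map_add' f g := by
    ext s
    simp only [eventGenerator, Pi.add_apply]
    have : ∀ i, (if i = 0 then r else 1) * (f (T i s) + g (T i s) - (f s + g s)) =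
      (if i = 0 then r else 1) * (f (T i s) - f s) +
        (if i = 0 then r else 1) * (g (T i s) - g s) := fun i => by ring
    simp only [this, Finset.sum_add_distrib]
    ring
  map_smul' c f := by
    ext s
    simp only [eventGenerator, Pi.smul_apply, smul_eq_mul, RingHom.id_apply, mul_add,
      Finset.mul_sum]
    congr 1
    exact Finset.sum_congr rfl fun i _ => by ring

omit [Fintype S] in
theorem anchoredGenerator_apply (f : S → ℝ) (s : S) :
    anchoredGenerator I T b r f s = eventGenerator I T r f s + f b := rfl

/-- The generator is nonpositive where `f` is maximal. Applied to preimages of point masses, this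
gives the nonnegativity of the invariant state. -/
theorem le_of_anchoredGenerator_nonneg (hr : 0 ≤ r) {f : S → ℝ}
    (h : ∀ s, 0 ≤ anchoredGenerator I T b r f s) : 0 ≤ f b := by
  have : Nonempty S := ⟨b⟩
  obtain ⟨m, hm⟩ := Finite.exists_max f
  have := h m
  rw [anchoredGenerator_apply] at this
  linarith [eventGenerator_nonpos (I := I) (T := T) hr hm]

theorem DrainsTo.anchoredGenerator_injective (hV : DrainsTo I T V b) (hr : 0 ≤ r) :
    Function.Injective (anchoredGenerator I T b r) := by
  rw [injective_iff_map_eq_zero]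
  intro f hf
  have h1 : 0 ≤ f b := le_of_anchoredGenerator_nonneg (I := I) (T := T) hr fun s => by simp [hf]
  have h2 : 0 ≤ (-f) b := le_of_anchoredGenerator_nonneg (I := I) (T := T) (f := -f) hr
    fun s => by simp [hf]
  have h0 : f b = 0 := by simp only [Pi.neg_apply] at h2; linarith
  have hG : ∀ s, eventGenerator I T r f s = 0 := fun s => by
    have := congrFun hf s
    rw [anchoredGenerator_apply, h0, add_zero] at this
    simpa using this
  ext t
  have h3 := hV.le_base_of_nonneg hr (f := f) (fun s => (hG s).ge) t
  have h4 := hV.le_base_of_nonneg hr (f := -f) (fun s => by rw [eventGenerator_neg, hG]; simp) t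
  simp only [Pi.neg_apply] at h4
  simp only [Pi.zero_apply]
  linarith

/-- Once the anchored generator is inverted, this determines every expectation, whence uniqueness
and analyticity. -/
theorem IsInvariantState.sum_mul_anchoredGenerator {μ : S → ℝ}
    (hμ : IsInvariantState (eventGenerator I T r) μ) (f : S → ℝ) :
    ∑ s, μ s * anchoredGenerator I T b r f s = f b := by
  simp only [anchoredGenerator_apply, mul_add, Finset.sum_add_distrib, hμ.2 f, zero_add,
    ← Finset.sum_mul, hμ.1.2, one_mul]

theorem DrainsTo.existsUnique (hV : DrainsTo I T V b) (hr : 0 ≤ r) :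
    ∃! μ : S → ℝ, IsInvariantState (eventGenerator I T r) μ := by
  classical
  set A := LinearEquiv.ofInjectiveEndo _ (hV.anchoredGenerator_injective hr) with hA
  have hAa : ∀ f, A f = anchoredGenerator I T b r f := fun f => rfl
  have hrep : ∀ f : S → ℝ, ∑ s, A.symm (Pi.single s 1) b * f s = A.symm f b := by
    intro f
    conv_rhs => rw [show f = ∑ s, f s • Pi.single s (1 : ℝ) by
      ext t; simp [Finset.sum_apply, Pi.single_apply]]
    simp only [map_sum, map_smul, Finset.sum_apply, Pi.smul_apply, smul_eq_mul]
    exact Finset.sum_congr rfl fun s _ => mul_comm _ _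
  have hone : A.symm (fun _ => (1 : ℝ)) = fun _ => 1 := by
    rw [LinearEquiv.symm_apply_eq]
    ext s
    simp [hAa, anchoredGenerator_apply, eventGenerator]
  refine ⟨fun s => A.symm (Pi.single s 1) b, ⟨⟨fun s => ?_, ?_⟩, fun f => ?_⟩, ?_⟩
  · refine le_of_anchoredGenerator_nonneg (I := I) (T := T) hr fun t => ?_
    rw [← hAa, LinearEquiv.apply_symm_apply]
    by_cases h : t = s <;> simp [h]
  · have := hrep fun _ => 1
    simpa [hone] using this
  · rw [hrep, show eventGenerator I T r f = A f - f b • fun _ => (1 : ℝ) by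
      ext s; simp [hAa, anchoredGenerator_apply]]
    simp [map_sub, hone]
  · intro μ hμ
    ext s
    have := hμ.sum_mul_anchoredGenerator (b := b) (A.symm (Pi.single s 1))
    rw [← hAa, LinearEquiv.apply_symm_apply] at this
    simpa [Pi.single_apply] using this

/-- Expectations in the invariant state are analytic in the rate of the event `0`, at rate `0`. -/
theorem DrainsTo.exists_analyticAt (hV : DrainsTo I T V b) (g : S → ℝ) :
    ∃ F : ℝ → ℝ, AnalyticAt ℝ F 0 ∧ ∀ᶠ r in 𝓝[>] (0 : ℝ),
      ∀ μ, IsInvariantState (eventGenerator I T r) μ → ∑ s, μ s * g s = F r := by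
  classical
  -- `A` is affine in `r` and invertible at `0`, so its inverse is analytic there.
  let A : ℝ → (S → ℝ) →L[ℝ] (S → ℝ) := fun r =>
    LinearMap.toContinuousLinearMap (anchoredGenerator I T b r)
  have hA : A = fun r => A 0 + r • (A 1 - A 0) := by
    funext r
    ext f s
    simp only [A, LinearMap.coe_toContinuousLinearMap', anchoredGenerator_apply, eventGenerator,
      add_apply, smul_apply, sub_apply,
      Pi.add_apply, Pi.smul_apply, Pi.sub_apply, smul_eq_mul, add_sub_add_right_eq_sub,
      ← Finset.sum_sub_distrib, Finset.mul_sum]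
    rw [add_right_comm, ← Finset.sum_add_distrib]
    congr 1
    refine Finset.sum_congr rfl fun i _ => ?_
    split_ifs <;> ring
  have hunit : ∀ r, 0 ≤ r → IsUnit (A r) := fun r hr => by
    have h := LinearMap.injective_iff_surjective.1 (hV.anchoredGenerator_injective hr)
    rw [ContinuousLinearMap.isUnit_iff_bijective]
    exact ⟨hV.anchoredGenerator_injective hr, h⟩
  have hana : AnalyticAt ℝ A 0 := by
    rw [hA]
    fun_prop
  obtain ⟨u, hu⟩ := hunit 0 le_rfl
  have hinv : AnalyticAt ℝ (fun r => Ring.inverse (A r)) 0 :=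
    AnalyticAt.comp (g := Ring.inverse) (by rw [← hu]; exact analyticAt_inverse u) hana
  refine ⟨fun r => Ring.inverse (A r) g b, ?_, ?_⟩
  · have h1 : AnalyticAt ℝ (fun r => ((ContinuousLinearMap.proj (R := ℝ) (φ := fun _ : S => ℝ) b).comp
      (ContinuousLinearMap.apply ℝ (S → ℝ) g)) (Ring.inverse (A r))) 0 :=
      (ContinuousLinearMap.analyticAt _ _).comp hinv
    exact h1
  · filter_upwards [self_mem_nhdsWithin] with r hr μ hμ
    have h := hμ.sum_mul_anchoredGenerator (b := b) (Ring.inverse (A r) g)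
    have h2 : anchoredGenerator I T b r (Ring.inverse (A r) g) = g := by
      change (A r * Ring.inverse (A r)) g = g
      rw [Ring.mul_inverse_cancel _ (hunit r (le_of_lt hr))]
      rfl
    rwa [h2] at h

open Classical in
/-- If the events `i ≠ 0` preserve `B k`, and the event `0` leads from `B k` to `B (k + 1)`, then
the complement of `B k` has probability of order `r ^ (k + 1)`. -/
theorem DrainsTo.exists_prob_bound (hV : DrainsTo I T V b) (B : ℕ → S → Prop) (hb : B 0 b)
    (hmono : ∀ k s, B k s → B (k + 1) s)
    (hfree : ∀ k i s, i ≠ 0 → B k s → B k (T i s))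
    (hslow : ∀ k s, B k s → B (k + 1) (T 0 s)) :
    ∃ M : ℝ, 0 ≤ M ∧ ∀ r, 0 ≤ r → ∀ μ, IsInvariantState (eventGenerator I T r) μ →
      ∀ k, ∑ s, μ s * (if B k s then 0 else 1) ≤ (M * r) ^ (k + 1) := by
  have : Nonempty S := ⟨b⟩
  obtain ⟨m, hm⟩ := Finite.exists_min V
  obtain ⟨m', hm'⟩ := Finite.exists_max V
  have hbB : ∀ k, B k b := fun k => by
    induction k with
    | zero => exact hb
    | succ k ih => exact hmono k b ih
  -- The constant is the oscillation of `V`, the most that one slow event can add to the truncated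
  -- potential `f` below.
  refine ⟨V m' - V m, by linarith [hm m'], fun r hr μ hμ => ?_⟩
  set M := V m' - V m with hM
  have hM0 : 0 ≤ M := by linarith [hm m']
  -- Stationarity applied to `f`: outside `B k` the fast events lower `f` at rate at least `1`, and
  -- the slow event raises it at rate at most `M * r * q`.
  have key : ∀ (k : ℕ) (q : S → ℝ), (∀ s, 0 ≤ q s) →
      (∀ s, (q s = 1 ∨ (B k s ∧ B k (T 0 s)))) →
      ∑ s, μ s * (if B k s then 0 else 1) ≤ M * r * ∑ s, μ s * q s := by
    intro k q hq0 hq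
    let f : S → ℝ := fun s => if B k s then 0 else V s - V m
    have hf0 : ∀ s, 0 ≤ f s := fun s => by
      by_cases h : B k s <;> simp [f, h, hm s]
    have hfV : ∀ s, f s ≤ V s - V m := fun s => by
      by_cases h : B k s <;> simp [f, h, hm s]
    have hfM : ∀ s, f s ≤ M := fun s => by linarith [hfV s, hm' s]
    have hgen : ∀ s, eventGenerator I T r f s ≤ M * r * q s - (if B k s then 0 else 1) := by
      intro s
      have hzero : r * (f (T 0 s) - f s) ≤ M * r * q s := by
        rcases hq s with h | ⟨h, h'⟩
        · rw [h]
          nlinarith [hfM (T 0 s), hf0 s]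
        · have : f (T 0 s) - f s = 0 := by simp [f, h, h']
          rw [this, mul_zero]
          exact mul_nonneg (mul_nonneg hM0 hr) (hq0 s)
      have hqM : 0 ≤ M * r * q s := mul_nonneg (mul_nonneg hM0 hr) (hq0 s)
      have hsplit : eventGenerator I T r f s =
          ∑ i ∈ I.filter (· = 0), r * (f (T 0 s) - f s) +
            ∑ i ∈ I.filter (¬ · = 0), (f (T i s) - f s) := by
        rw [eventGenerator, ← Finset.sum_filter_add_sum_filter_not I (· = 0)]
        congr 1 <;> refine Finset.sum_congr rfl fun i hi => ?_
        · have := (Finset.mem_filter.1 hi).2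
          simp [this]
        · have := (Finset.mem_filter.1 hi).2
          simp [this]
      have hfirst : ∑ i ∈ I.filter (· = 0), r * (f (T 0 s) - f s) ≤ M * r * q s := by
        rw [Finset.filter_eq']
        split_ifs <;> simpa using by assumption
      have hsecond : ∑ i ∈ I.filter (¬ · = 0), (f (T i s) - f s) ≤ -(if B k s then 0 else 1) := by
        by_cases h : B k s
        · simp only [h, if_true, neg_zero]
          refine Finset.sum_nonpos fun i hi => ?_
          have := hfree k i s (Finset.mem_filter.1 hi).2 h
          simp [f, h, this]
        · simp only [h, if_false]
          obtain ⟨i, hi, hi0, hd⟩ := hV.drop s fun e => h (e ▸ hbB k)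
          have hfs : f s = V s - V m := by simp [f, h]
          have hi' : i ∈ I.filter (¬ · = 0) := Finset.mem_filter.2 ⟨hi, hi0⟩
          have hnp : ∀ j ∈ I.filter (¬ · = 0), f (T j s) - f s ≤ 0 := fun j hj => by
            have := hV.le j (Finset.mem_filter.1 hj).1 (Finset.mem_filter.1 hj).2 s
            linarith [hfV (T j s)]
          calc _ ≤ f (T i s) - f s := by
                rw [← Finset.add_sum_erase _ _ hi']
                exact add_le_of_nonpos_right
                  (Finset.sum_nonpos fun j hj => hnp j (Finset.mem_of_mem_erase hj))
            _ ≤ -1 := by linarith [hfV (T i s)]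
      rw [hsplit]
      linarith
    have h0 := hμ.2 f
    have h1 : ∑ s, μ s * eventGenerator I T r f s ≤
        ∑ s, μ s * (M * r * q s - (if B k s then 0 else 1)) :=
      Finset.sum_le_sum fun s _ => mul_le_mul_of_nonneg_left (hgen s) (hμ.1.1 s)
    simp only [mul_sub, Finset.sum_sub_distrib] at h1
    rw [Finset.mul_sum]
    have h2 : ∑ s, M * r * (μ s * q s) = ∑ s, μ s * (M * r * q s) :=
      Finset.sum_congr rfl fun s _ => by ring
    linarith
  intro k
  induction k with
  | zero =>
    have := key 0 (fun _ => 1) (fun _ => zero_le_one) fun s => Or.inl rfl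
    simpa [hμ.1.2] using this
  | succ k ih =>
    -- From `B k` the slow event stays in `B (k + 1)`, where `f` vanishes, so only the complement of
    -- `B k` feeds the complement of `B (k + 1)`.
    have := key (k + 1) (fun s => if B k s then 0 else 1) (fun s => by split_ifs <;> simp)
      fun s => by
        by_cases h : B k s
        · exact Or.inr ⟨hmono k s h, hslow k s h⟩
        · exact Or.inl (if_neg h)
    calc _ ≤ _ := this
      _ ≤ M * r * (M * r) ^ (k + 1) := mul_le_mul_of_nonneg_left ih (mul_nonneg hM0 hr)
      _ = _ := by ring

end Chain

/-! ### The open chain driven by jumps on `ℤ` between reservoirs. -/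

/-- The attempted jump from `i` to `i + 1`, for configurations on `ℤ`. -/
def hop (i : ℤ) (z : ℤ → Bool) (k : ℤ) : Bool :=
  if k = i then z i && z (i + 1) else if k = i + 1 then z i || z (i + 1) else z k

theorem hop_of_ne {i k : ℤ} (z : ℤ → Bool) (h : k ≠ i) (h' : k ≠ i + 1) : hop i z k = z k := by
  simp [hop, h, h']

theorem hop_self (i : ℤ) (z : ℤ → Bool) : hop i z i = (z i && z (i + 1)) := by simp [hop]

theorem hop_succ (i : ℤ) (z : ℤ → Bool) : hop i z (i + 1) = (z i || z (i + 1)) := by simp [hop]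

namespace TasepConfig

variable {L : ℕ}

/-- The configuration on `ℤ` with all sites to the left of the chain occupied and all sites to the
right of it vacant. -/
noncomputable def extend (η : TasepConfig L L) (k : ℤ) : Bool :=
  if h : k ∈ Finset.Ioc (-(L : ℤ)) (L : ℤ) then η ⟨k, h⟩ else decide (k ≤ 0)

/-- The attempted jump from `i` to `i + 1`, where the sites to the left of the chain are occupied
and those to the right of it are vacant. -/
noncomputable def event (i : ℤ) (η : TasepConfig L L) : TasepConfig L L := fun k => hop i η.extend k

/-- All sites up to `0` are occupied, all others are vacant. -/
def step (L : ℕ) : TasepConfig L L := fun k => decide ((k : ℤ) ≤ 0)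

theorem extend_coe (η : TasepConfig L L) (k : TasepSite L L) : η.extend k = η k := by
  simp [extend, k.2]

theorem extend_of_le (η : TasepConfig L L) {k : ℤ} (h : k ≤ -L) : η.extend k = true := by
  have h1 : k ∉ Finset.Ioc (-(L : ℤ)) (L : ℤ) := by simp only [Finset.mem_Ioc]; omega
  have h2 : k ≤ 0 := by omega
  simp [extend, h1, h2]

theorem extend_of_lt (η : TasepConfig L L) {k : ℤ} (h : L < k) : η.extend k = false := by
  have h1 : k ∉ Finset.Ioc (-(L : ℤ)) (L : ℤ) := by simp only [Finset.mem_Ioc]; omega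
  have h2 : ¬ k ≤ 0 := by omega
  simp only [extend, h1, h2, dite_false, decide_false]

theorem extend_event (i : ℤ) (η : TasepConfig L L) {k : ℤ} (h1 : -(L : ℤ) < k) (h2 : k ≤ L) :
    (event i η).extend k = hop i η.extend k := by
  have h : k ∈ Finset.Ioc (-(L : ℤ)) (L : ℤ) := Finset.mem_Ioc.2 ⟨h1, h2⟩
  rw [extend, dif_pos h]
  rfl

theorem extend_step (k : ℤ) : (step L).extend k = decide (k ≤ 0) := by
  by_cases h : k ∈ Finset.Ioc (-(L : ℤ)) (L : ℤ) <;> simp only [extend, step, h] <;> simp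

theorem event_eq_self {i : ℤ} (h : i ∉ Finset.Icc (-(L : ℤ)) L) (η : TasepConfig L L) :
    event i η = η := by
  funext k
  have hk := Finset.mem_Ioc.1 k.2
  rw [Finset.mem_Icc] at h
  rw [event, hop_of_ne _ (by omega) (by omega), extend_coe]

theorem event_eq_jump (η : TasepConfig L L) {i j : TasepSite L L} (h : (i : ℤ) + 1 = j) :
    event i η = η.jump i j := by
  funext k
  have hij : i ≠ j := fun e => by rw [e] at h; omega
  simp only [event, hop, jump, h, extend_coe, ← Subtype.ext_iff]
  by_cases hk : k = i
  · subst hk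
    cases hi : η k <;> cases hj : η j <;> simp [hij]
  · by_cases hk' : k = j
    · subst hk'
      cases hi : η i <;> cases hj : η k <;> simp [hk]
    · simp [hk, hk']

theorem event_eq_enter (η : TasepConfig L L) :
    event (-(L : ℤ)) η = η.setSite (-(L : ℤ) + 1) true := by
  funext k
  have hk := Finset.mem_Ioc.1 k.2
  have h : (k : ℤ) ≠ -L := by omega
  simp only [event, hop, setSite, h, if_false, extend_of_le η le_rfl, Bool.true_or, extend_coe]

theorem event_eq_leave (η : TasepConfig L L) :
    event (L : ℤ) η = η.setSite (L : ℤ) false := by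
  funext k
  have hk := Finset.mem_Ioc.1 k.2
  have h : (k : ℤ) ≠ L + 1 := by omega
  simp only [event, hop, setSite, h, if_false, extend_of_lt η (lt_add_one (L : ℤ)), Bool.and_false,
    extend_coe]

/-- Entry and exit are jumps from and to the reservoirs, and events beyond them change nothing. The
larger window `M` lets two chains share one set of events. -/
theorem generator_eq {M : ℕ} (hL : 1 ≤ L) (hM : L ≤ M) (r : ℝ) :
    tasepGenerator L L r 1 1 = eventGenerator (Finset.Icc (-(M : ℤ)) M) event r := by
  funext f η
  set c : ℤ → ℝ := fun i => (if i = 0 then r else 1) * (f (event i η) - f η) with hc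
  have h1 : eventGenerator (Finset.Icc (-(M : ℤ)) M) event r f η =
      ∑ i ∈ Finset.Icc (-(L : ℤ)) L, c i := by
    refine (Finset.sum_subset (Finset.Icc_subset_Icc (by omega) (by omega)) fun i _ hi => ?_).symm
    rw [event_eq_self hi, sub_self, mul_zero]
  have h2 : ∑ i ∈ Finset.Icc (-(L : ℤ)) L, c i =
      c (-L) + (∑ i ∈ Finset.Ioo (-(L : ℤ)) L, c i) + c L := by
    rw [← Finset.Ioc_insert_left (by omega), Finset.sum_insert (by simp),
      ← Finset.Ioo_insert_right (by omega), Finset.sum_insert (by simp)]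
    ring
  have h3 : ∀ i : TasepSite L L, (∑ j : TasepSite L L,
      if (i : ℤ) + 1 = j then (if (i : ℤ) = 0 then r else 1) * (f (η.jump i j) - f η) else 0) =
      if (i : ℤ) < L then c i else 0 := by
    intro i
    have hi := Finset.mem_Ioc.1 i.2
    by_cases h : (i : ℤ) < L
    · rw [if_pos h, Finset.sum_eq_single (⟨(i : ℤ) + 1, Finset.mem_Ioc.2 (by omega)⟩ : TasepSite L L)]
      · rw [if_pos rfl, hc]
        dsimp only
        rw [event_eq_jump η (j := ⟨(i : ℤ) + 1, Finset.mem_Ioc.2 (by omega)⟩) rfl]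
      · intro j _ hj
        rw [if_neg fun e => hj (Subtype.ext e.symm)]
      · simp
    · rw [if_neg h]
      refine Finset.sum_eq_zero fun j _ => if_neg ?_
      have hj := Finset.mem_Ioc.1 j.2
      omega
  have h4 : ∑ i : TasepSite L L, (if (i : ℤ) < L then c i else 0) =
      ∑ i ∈ Finset.Ioo (-(L : ℤ)) L, c i := by
    rw [Finset.sum_coe_sort (Finset.Ioc (-(L : ℤ)) L) (fun i => if i < L then c i else 0),
      ← Finset.Ioo_insert_right (by omega), Finset.sum_insert (by simp), if_neg (lt_irrefl _),
      zero_add]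
    exact Finset.sum_congr rfl fun i hi => if_pos (Finset.mem_Ioo.1 hi).2
  rw [h1, h2, tasepGenerator, Finset.sum_congr rfl fun i _ => h3 i, h4, hc]
  dsimp only
  rw [event_eq_enter, event_eq_leave, if_neg (by omega), if_neg (by omega)]

theorem isTasepStationary_iff {M : ℕ} (hL : 1 ≤ L) (hM : L ≤ M) (r : ℝ)
    (μ : TasepConfig L L → ℝ) : IsTasepStationary L L r 1 1 μ ↔
      IsInvariantState (eventGenerator (Finset.Icc (-(M : ℤ)) M) event r) μ := by
  rw [IsTasepStationary, IsInvariantState, generator_eq hL hM]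

/-- The contribution of a particle at `k` to the drift: away from the blockage, each jump lowers it
by `1`. -/
noncomputable def siteWeight (L : ℕ) (k : ℤ) : ℝ := if k ≤ 0 then -((k : ℝ) + L) else L + 1 - k

/-- The total number of jumps, other than those across the blockage, that lead to `step L`, up to
an additive constant. -/
noncomputable def potential (η : TasepConfig L L) : ℝ :=
  ∑ k ∈ Finset.Icc (-(L : ℤ)) (L + 1), if η.extend k then siteWeight L k else 0

/-- The weights vanish at the reservoir sites `-L` and `L + 1`, so resetting these costs nothing and
entries and exits count as ordinary jumps. -/
theorem potential_event {i : ℤ} (hi : i ∈ Finset.Icc (-(L : ℤ)) L) (η : TasepConfig L L) :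
    potential (event i η) = potential η +
      if η.extend i = true ∧ η.extend (i + 1) = false
        then siteWeight L (i + 1) - siteWeight L i else 0 := by
  have hi' := Finset.mem_Icc.1 hi
  have h1 : potential (event i η) =
      ∑ k ∈ Finset.Icc (-(L : ℤ)) (L + 1), if hop i η.extend k then siteWeight L k else 0 := by
    refine Finset.sum_congr rfl fun k hk => ?_
    have hk' := Finset.mem_Icc.1 hk
    rcases eq_or_lt_of_le hk'.1 with h | h
    · simp [siteWeight, ← h]
    rcases eq_or_lt_of_le hk'.2 with h' | h'
    · have h0 : ¬ k ≤ 0 := by omega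
      have hw : siteWeight L k = 0 := by rw [siteWeight, if_neg h0, h']; push_cast; ring
      simp [hw]
    · rw [extend_event i η h (by omega)]
  have ha : i ∈ Finset.Icc (-(L : ℤ)) (L + 1) := Finset.mem_Icc.2 (by omega)
  have hb : i + 1 ∈ (Finset.Icc (-(L : ℤ)) (L + 1)).erase i :=
    Finset.mem_erase.2 ⟨by omega, Finset.mem_Icc.2 (by omega)⟩
  rw [h1, potential, ← Finset.add_sum_erase _ _ ha, ← Finset.add_sum_erase _ _ hb,
    ← Finset.add_sum_erase (Finset.Icc (-(L : ℤ)) (L + 1)) _ ha,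
    ← Finset.add_sum_erase (Finset.erase _ _) _ hb, hop_self, hop_succ]
  have hrest : ∑ k ∈ ((Finset.Icc (-(L : ℤ)) (L + 1)).erase i).erase (i + 1),
        (if hop i η.extend k then siteWeight L k else 0) =
      ∑ k ∈ ((Finset.Icc (-(L : ℤ)) (L + 1)).erase i).erase (i + 1),
        if η.extend k then siteWeight L k else 0 := by
    refine Finset.sum_congr rfl fun k hk => ?_
    have hk1 := Finset.ne_of_mem_erase hk
    have hk2 := Finset.ne_of_mem_erase (Finset.mem_of_mem_erase hk)
    rw [hop_of_ne _ hk2 hk1]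
  rw [hrest]
  cases η.extend i <;> cases η.extend (i + 1) <;> simp
  ring

theorem siteWeight_succ (L : ℕ) {i : ℤ} (hi : i ≠ 0) :
    siteWeight L (i + 1) - siteWeight L i = -1 := by
  rcases lt_or_gt_of_ne hi with h | h
  · rw [siteWeight, siteWeight, if_pos (by omega), if_pos (by omega)]
    push_cast
    ring
  · rw [siteWeight, siteWeight, if_neg (by omega), if_neg (by omega)]
    push_cast
    ring

/-- If nothing can move, occupation propagates from the left reservoir up to `0`, while a particle
to the right of the blockage would propagate into the empty site `L + 1`. -/
theorem exists_active {η : TasepConfig L L} (h : η ≠ step L) :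
    ∃ i ∈ Finset.Icc (-(L : ℤ)) L, i ≠ 0 ∧ η.extend i = true ∧ η.extend (i + 1) = false := by
  by_contra! hno
  have hprop : ∀ i, -(L : ℤ) ≤ i → i ≤ L → i ≠ 0 → η.extend i = true → η.extend (i + 1) = true :=
    fun i h1 h2 h0 ht => by simpa using hno i (Finset.mem_Icc.2 ⟨h1, h2⟩) h0 ht
  have hleft : ∀ k, -(L : ℤ) ≤ k → k ≤ 0 → η.extend k = true := by
    intro k hk
    induction k, hk using Int.leInduction with
    | base => exact fun _ => extend_of_le η le_rfl
    | succ k hk ih => exact fun hk0 => hprop k hk (by omega) (by omega) (ih (by omega))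
  have hright : ∀ k, 1 ≤ k → η.extend k = false := by
    intro k hk
    by_contra hne
    have hup : ∀ l, k ≤ l → l ≤ L + 1 → η.extend l = true := by
      intro l hl
      induction l, hl using Int.leInduction with
      | base => exact fun _ => by simpa using hne
      | succ l hl ih => exact fun hlL => hprop l (by omega) (by omega) (by omega) (ih (by omega))
    rcases le_or_gt k (L + 1) with hkL | hkL
    · simpa [extend_of_lt η (lt_add_one (L : ℤ))] using hup (L + 1) hkL le_rfl
    · exact hne (extend_of_lt η (by omega))
  refine h (funext fun k => ?_)
  have hk := Finset.mem_Ioc.1 k.2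
  rw [← extend_coe η k, step]
  by_cases h0 : (k : ℤ) ≤ 0
  · simp [h0, hleft k (by omega) h0]
  · simp [h0, hright k (by omega)]

theorem potential_event_le {i : ℤ} (hi : i ≠ 0) (η : TasepConfig L L) :
    potential (event i η) ≤ potential η := by
  by_cases hI : i ∈ Finset.Icc (-(L : ℤ)) L
  · rw [potential_event hI, siteWeight_succ L hi]
    split_ifs <;> linarith
  · rw [event_eq_self hI]

theorem exists_potential_event_le {η : TasepConfig L L} (h : η ≠ step L) :
    ∃ i ∈ Finset.Icc (-(L : ℤ)) L, i ≠ 0 ∧ potential (event i η) ≤ potential η - 1 := by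
  obtain ⟨i, hI, hi, ha⟩ := exists_active h
  refine ⟨i, hI, hi, ?_⟩
  rw [potential_event hI, siteWeight_succ L hi, if_pos ha]
  linarith

theorem drainsTo {M : ℕ} (hM : L ≤ M) :
    DrainsTo (Finset.Icc (-(M : ℤ)) M) (event (L := L)) potential (step L) where
  le i _ hi η := potential_event_le hi η
  drop η h := by
    obtain ⟨i, hI, hi⟩ := exists_potential_event_le h
    exact ⟨i, Finset.Icc_subset_Icc (by omega) (by omega) hI, hi⟩

theorem canCross_iff (hL : 1 ≤ L) (η : TasepConfig L L) :
    η.CanCross ↔ η.extend 0 = true ∧ η.extend 1 = false := by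
  constructor
  · rintro ⟨i, j, hi, hj, h⟩
    rwa [← extend_coe η i, ← extend_coe η j, hi, hj] at h
  · intro h
    refine ⟨⟨0, Finset.mem_Ioc.2 (by omega)⟩, ⟨1, Finset.mem_Ioc.2 (by omega)⟩, rfl, rfl, ?_⟩
    rwa [← extend_coe η, ← extend_coe η]

/-- The event `i`, in two chains at once. -/
noncomputable def pairEvent {L M : ℕ} (i : ℤ) (p : TasepConfig L L × TasepConfig M M) :
    TasepConfig L L × TasepConfig M M := (event i p.1, event i p.2)

theorem drainsTo_pair {M : ℕ} (hM : L ≤ M) :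
    DrainsTo (Finset.Icc (-(M : ℤ)) M) (pairEvent (L := L) (M := M))
      (fun p => potential p.1 + potential p.2) (step L, step M) where
  le i _ hi p := add_le_add (potential_event_le hi _) (potential_event_le hi _)
  drop p hp := by
    by_cases h : p.1 = step L
    · have h' : p.2 ≠ step M := fun e => hp (Prod.ext h e)
      obtain ⟨i, hI, hi, hd⟩ := exists_potential_event_le h'
      exact ⟨i, hI, hi, by simp only [pairEvent]; linarith [potential_event_le hi p.1]⟩
    · obtain ⟨i, hI, hi, hd⟩ := exists_potential_event_le h
      exact ⟨i, Finset.Icc_subset_Icc (by omega) (by omega) hI, hi, by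
        simp only [pairEvent]; linarith [potential_event_le hi p.2]⟩

end TasepConfig

/-! ### Discrepancies of two coupled chains, left of the blockage. -/

/-- The number of vacant sites in `(x, 0]`. -/
noncomputable def holes (z : ℤ → Bool) (x : ℤ) : ℤ := ∑ w ∈ Finset.Ioc x 0, if z w then 0 else 1

theorem holes_zero (z : ℤ → Bool) : holes z 0 = 0 := by simp [holes]

theorem holes_eq_add (z : ℤ → Bool) {x : ℤ} (hx : x < 0) :
    holes z x = holes z (x + 1) + if z (x + 1) then 0 else 1 := by
  have h : Finset.Ioc x 0 = insert (x + 1) (Finset.Ioc (x + 1) 0) := by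
    ext w
    simp only [Finset.mem_Ioc, Finset.mem_insert]
    omega
  rw [holes, h, Finset.sum_insert (by simp), holes, add_comm]

theorem holes_sub_holes {z z' : ℤ → Bool} {x j : ℤ} (hj : j ≤ 0) (hx : x ≤ j)
    (h : ∀ w, x < w → w ≤ j → z' w = z w) : holes z' x - holes z x = holes z' j - holes z j := by
  induction x, hx using Int.leInductionDown with
  | base => rfl
  | pred x hx ih =>
    rw [← ih fun w hw => h w (by omega), holes_eq_add z (by omega), holes_eq_add z' (by omega),
      sub_add_cancel, h x (by omega) hx]
    ring

theorem holes_congr {z z' : ℤ → Bool} {x : ℤ} (h : ∀ w, x < w → w ≤ 0 → z' w = z w) :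
    holes z' x = holes z x :=
  Finset.sum_congr rfl fun w hw => by rw [h w (Finset.mem_Ioc.1 hw).1 (Finset.mem_Ioc.1 hw).2]

/-- On the left of the blockage, at most `k` particles that have crossed it account for the vacant
sites and for the discrepancies between the configurations `z`, of a chain with `L` sites, and `y`,
of a longer chain: a discrepancy arises at the site `-L`, and is moved to the right by vacant
sites only. -/
structure LeftOrder (L : ℕ) (k : ℤ) (z y : ℤ → Bool) : Prop where
  le : ∀ x, -(L : ℤ) < x → x ≤ 0 → y x = true → z x = true
  holes_le : holes z (-L) ≤ k
  discrepancy_le : ∀ x, -(L : ℤ) ≤ x → x ≤ 0 → z x = true → y x = false →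
    x + L + 1 + holes z x ≤ k

/-- `z'` and `y'` arise from `z` and `y` by an attempted jump from `i` to `i + 1`, where the site
`-L` stays occupied in the first configuration, and may be filled in the second one. -/
structure LeftUpdate (L : ℕ) (i : ℤ) (z y z' y' : ℤ → Bool) : Prop where
  pin : z (-L) = true
  pin' : z' (-L) = true
  left : ∀ x, -(L : ℤ) < x → x ≤ 0 → z' x = hop i z x
  right : ∀ x, -(L : ℤ) < x → x ≤ 0 → y' x = hop i y x
  right_pin : y' (-L) = false → hop i y (-L) = false

namespace LeftOrder

variable {L : ℕ} {i k : ℤ} {z y z' y' : ℤ → Bool}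

theorem mono {k' : ℤ} (h : LeftOrder L k z y) (hk : k ≤ k') : LeftOrder L k' z y where
  le := h.le
  holes_le := h.holes_le.trans hk
  discrepancy_le x h1 h2 h3 h4 := (h.discrepancy_le x h1 h2 h3 h4).trans hk

theorem apply_zero_eq (h : LeftOrder L k z y) (hL : 1 ≤ L) (hk : k ≤ L) : z 0 = y 0 := by
  have h1 := h.le 0 (by omega) le_rfl
  have h2 := h.discrepancy_le 0 (by omega) le_rfl
  rw [holes_zero] at h2
  cases hz : z 0 <;> cases hy : y 0 <;> simp_all
  omega

/-- Since the chains agree at `0` and `1`, both perform the same jump: no discrepancy arises at `0`,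
and at most one vacancy is added. -/
theorem update_zero (h : LeftOrder L k z y) (u : LeftUpdate L 0 z y z' y') (hL : 1 ≤ L)
    (h0 : z 0 = y 0) (h1 : z 1 = y 1) : LeftOrder L (k + 1) z' y' := by
  have hz0 : z' 0 = y' 0 := by
    rw [u.left 0 (by omega) le_rfl, u.right 0 (by omega) le_rfl, hop_self, hop_self, zero_add, h0,
      h1]
  have hz : ∀ x, -(L : ℤ) < x → x < 0 → z' x = z x := fun x hx hx' => by
    rw [u.left x hx hx'.le, hop_of_ne _ (by omega) (by omega)]
  have hy : ∀ x, -(L : ℤ) < x → x < 0 → y' x = y x := fun x hx hx' => by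
    rw [u.right x hx hx'.le, hop_of_ne _ (by omega) (by omega)]
  have hholes : ∀ x, -(L : ℤ) ≤ x → x < 0 → holes z' x ≤ holes z x + 1 := fun x hx hx' => by
    have e := holes_sub_holes (z := z) (z' := z') (j := -1) (x := x) (by omega) (by omega)
      fun w hw hw' => hz w (by omega) (by omega)
    have e1 := holes_eq_add z (x := -1) (by omega)
    have e2 := holes_eq_add z' (x := -1) (by omega)
    rw [neg_add_cancel, holes_zero] at e1 e2
    split_ifs at e1 e2 <;> omega
  refine ⟨fun x hx hx' hyx => ?_, ?_, fun x hx hx' hzx hyx => ?_⟩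
  · rcases eq_or_lt_of_le hx' with e | e
    · rw [e, hz0, ← e, hyx]
    · rw [hz x hx e]
      rw [hy x hx e] at hyx
      exact h.le x hx hx' hyx
  · linarith [hholes (-L) le_rfl (by omega), h.holes_le]
  · rcases eq_or_lt_of_le hx' with e | e
    · rw [e] at hzx hyx
      rw [hz0, hyx] at hzx
      simp at hzx
    · have hd : z x = true ∧ y x = false := by
        rcases eq_or_lt_of_le hx with e' | e'
        · subst e'
          have := u.right_pin hyx
          rw [hop_of_ne _ (by omega) (by omega)] at this
          exact ⟨u.pin, this⟩
        · rw [hz x e' e] at hzx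
          rw [hy x e' e] at hyx
          exact ⟨hzx, hyx⟩
      linarith [hholes x hx e, h.discrepancy_le x hx hx' hd.1 hd.2]

theorem update_of_pos (h : LeftOrder L k z y) (u : LeftUpdate L i z y z' y') (hi : 0 < i) :
    LeftOrder L k z' y' := by
  have hz : ∀ x, -(L : ℤ) < x → x ≤ 0 → z' x = z x := fun x hx hx' => by
    rw [u.left x hx hx', hop_of_ne _ (by omega) (by omega)]
  have hy : ∀ x, -(L : ℤ) < x → x ≤ 0 → y' x = y x := fun x hx hx' => by
    rw [u.right x hx hx', hop_of_ne _ (by omega) (by omega)]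
  have hh : ∀ x, -(L : ℤ) ≤ x → holes z' x = holes z x := fun x hx =>
    holes_congr fun w hw => hz w (by omega)
  refine ⟨fun x hx hx' hyx => ?_, ?_, fun x hx hx' hzx hyx => ?_⟩
  · rw [hz x hx hx']
    exact h.le x hx hx' (by rwa [← hy x hx hx'])
  · rw [hh _ le_rfl]
    exact h.holes_le
  · rw [hh x hx]
    rcases eq_or_lt_of_le hx with e' | e'
    · subst e'
      have := u.right_pin hyx
      rw [hop_of_ne _ (by omega) (by omega)] at this
      exact h.discrepancy_le _ hx hx' u.pin this
    · exact h.discrepancy_le x hx hx' (by rwa [← hz x e' hx']) (by rwa [← hy x e' hx'])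

/-- A discrepancy moving right trades one unit of `x` for one vacancy ahead of it, so the bound is
conserved; moving left only lowers it. -/
theorem update_of_neg (h : LeftOrder L k z y) (u : LeftUpdate L i z y z' y') (hi : i < 0) :
    LeftOrder L k z' y' := by
  have hz : ∀ x, -(L : ℤ) < x → x ≤ 0 → x ≠ i → x ≠ i + 1 → z' x = z x :=
    fun x hx hx' h1 h2 => by rw [u.left x hx hx', hop_of_ne _ h1 h2]
  have hright : ∀ x, -(L : ℤ) ≤ x → i + 1 ≤ x → holes z' x = holes z x := fun x hx hx' =>
    holes_congr fun w hw hw' => hz w (by omega) hw' (by omega) (by omega)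
  have hat : -(L : ℤ) ≤ i →
      holes z' i = holes z (i + 1) + if (z i || z (i + 1)) then 0 else 1 := fun hLi => by
    rw [holes_eq_add z' hi, hright _ (by omega) le_rfl, u.left (i + 1) (by omega) (by omega),
      hop_succ]
  have hat' := holes_eq_add z hi
  have hleft : ∀ x, -(L : ℤ) ≤ x → x < i → holes z' x = holes z x := fun x hx hx' => by
    have e := holes_sub_holes (z := z) (z' := z') (j := i - 1) (x := x) (by omega) (by omega)
      fun w hw hw' => hz w (by omega) (by omega) (by omega) (by omega)
    have e1 := holes_eq_add z (x := i - 1) (by omega)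
    have e2 := holes_eq_add z' (x := i - 1) (by omega)
    rw [sub_add_cancel] at e1 e2
    rw [u.left i (by omega) (by omega), hop_self] at e2
    have e3 := hat (by omega)
    cases hzi : z i <;> cases hzi' : z (i + 1) <;> simp [hzi, hzi'] at e1 e2 e3 hat' <;> omega
  refine ⟨fun x hx hx' hyx => ?_, ?_, fun x hx hx' hzx hyx => ?_⟩
  · rw [u.left x hx hx']
    rw [u.right x hx hx'] at hyx
    by_cases h1 : x = i
    · subst h1
      rw [hop_self, Bool.and_eq_true] at hyx ⊢
      exact ⟨h.le x hx hx' hyx.1, h.le (x + 1) (by omega) (by omega) hyx.2⟩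
    by_cases h2 : x = i + 1
    · subst h2
      rw [hop_succ, Bool.or_eq_true] at hyx ⊢
      rcases hyx with hyx | hyx
      · rcases eq_or_lt_of_le (show -(L : ℤ) ≤ i by omega) with e | e
        · exact Or.inl (e ▸ u.pin)
        · exact Or.inl (h.le i e (by omega) hyx)
      · exact Or.inr (h.le _ hx hx' hyx)
    · rw [hop_of_ne _ h1 h2] at hyx ⊢
      exact h.le x hx hx' hyx
  · refine le_trans ?_ h.holes_le
    rcases lt_trichotomy i (-(L : ℤ)) with e | e | e
    · exact (hright _ le_rfl (by omega)).le
    · rw [← e]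
      have := hat e.ge
      have hp : z i = true := e ▸ u.pin
      rw [hp] at this
      simp only [Bool.true_or, if_true] at this
      split_ifs at hat' <;> omega
    · exact (hleft _ le_rfl e).le
  · have hyx' : hop i y x = false := by
      rcases eq_or_lt_of_le hx with e | e
      · subst e
        exact u.right_pin hyx
      · rwa [← u.right x e hx']
    have hd := fun w hw hw' => h.discrepancy_le w hw hw'
    by_cases h1 : x = i
    · subst h1
      rw [hop_self, Bool.and_eq_false_iff] at hyx'
      have hzi : z x = true := by
        rcases eq_or_lt_of_le hx with e | e
        · exact e ▸ u.pin
        · rw [u.left x e hx', hop_self, Bool.and_eq_true] at hzx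
          exact hzx.1
      have e1 := hat hx
      simp only [hzi, Bool.true_or, if_true] at e1
      have e2 := hd x hx hx' hzi
      have e3 := hd (x + 1) (by omega) (by omega)
      cases hzi' : z (x + 1) with
      | true =>
        simp only [hzi', if_true] at hat'
        rcases hyx' with hyx' | hyx'
        · have := e2 hyx'
          omega
        · have := e3 hzi' hyx'
          omega
      | false =>
        simp only [hzi', Bool.false_eq_true, if_false] at hat'
        -- At the pinned site `-L`, the particle entering the short chain fills a vacancy, which
        -- pays for the discrepancy at `-L`.
        rcases eq_or_lt_of_le hx with e | e
        · have := h.holes_le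
          rw [e] at this
          omega
        · rw [u.left x e hx', hop_self, hzi', Bool.and_false] at hzx
          simp at hzx
    by_cases h2 : x = i + 1
    · subst h2
      rw [hop_succ, Bool.or_eq_false_iff] at hyx'
      rw [hright _ hx le_rfl]
      cases hzi' : z (i + 1) with
      | true => exact hd _ hx hx' hzi' hyx'.2
      | false =>
        rcases eq_or_lt_of_le hx with e | e
        · rw [← e, u.pin] at hzi'
          simp at hzi'
        · rw [u.left _ e hx', hop_succ, hzi', Bool.or_false] at hzx
          -- The discrepancy has come from `i`, and the vacancy it used was at `i + 1`.
          have := hd i (by omega) (by omega) hzx hyx'.1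
          simp only [hzi', Bool.false_eq_true, if_false] at hat'
          omega
    · rw [hop_of_ne _ h1 h2] at hyx'
      have hzx' : z x = true := by
        rcases eq_or_lt_of_le hx with e | e
        · exact e ▸ u.pin
        · rwa [← hz x e hx' h1 h2]
      have := hd x hx hx' hzx' hyx'
      rcases lt_or_gt_of_ne h1 with e | e
      · rwa [hleft x hx e]
      · rwa [hright x hx e]

theorem update (h : LeftOrder L k z y) (u : LeftUpdate L i z y z' y') (hi : i ≠ 0) :
    LeftOrder L k z' y' :=
  (lt_or_gt_of_ne hi).elim (h.update_of_neg u) (h.update_of_pos u)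

theorem refl_of_forall (hz : ∀ x ≤ 0, z x = true) (hy : ∀ x ≤ 0, y x = true) :
    LeftOrder L 0 z y where
  le x _ hx _ := hz x hx
  holes_le := (Finset.sum_eq_zero fun w hw => by rw [if_pos (hz w (Finset.mem_Ioc.1 hw).2)]).le
  discrepancy_le x _ hx _ hyx := by simp [hy x hx] at hyx

end LeftOrder

/-! ### Reflection, and the order of a pair of chains on both sides. -/

/-- The particle-hole reflection about the bond between `0` and `1`. -/
def reflect (z : ℤ → Bool) (k : ℤ) : Bool := !z (1 - k)

theorem hop_reflect (i : ℤ) (z : ℤ → Bool) (k : ℤ) :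
    hop (-i) (reflect z) k = !hop i z (1 - k) := by
  have e1 : (1 - -i : ℤ) = i + 1 := by ring
  have e2 : (1 - (-i + 1) : ℤ) = i := by ring
  by_cases h1 : k = -i
  · subst h1
    rw [hop_self, e1, hop_succ, reflect, reflect, e1, e2, Bool.not_or, Bool.and_comm]
  by_cases h2 : k = -i + 1
  · subst h2
    rw [hop_succ, e2, hop_self, reflect, reflect, e1, e2, Bool.not_and, Bool.or_comm]
  · rw [hop_of_ne _ h1 h2, hop_of_ne _ (by omega) (by omega), reflect]

namespace TasepConfig

variable {L M : ℕ}

theorem leftUpdate (hM : L ≤ M) (i : ℤ) (p : TasepConfig L L × TasepConfig M M) :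
    LeftUpdate L i p.1.extend p.2.extend (pairEvent i p).1.extend (pairEvent i p).2.extend where
  pin := extend_of_le _ le_rfl
  pin' := extend_of_le _ le_rfl
  left x hx hx' := extend_event i p.1 hx (by omega)
  right x hx hx' := extend_event i p.2 (by omega) (by omega)
  -- For `M = L` the site `-L` is a reservoir site of both chains and is never vacant; for `L < M`
  -- it is a proper site of the longer chain.
  right_pin h := by
    rcases eq_or_lt_of_le hM with e | e
    · rw [extend_of_le _ (by omega)] at h
      simp at h
    · rwa [pairEvent, extend_event i p.2 (by omega) (by omega)] at h

theorem leftUpdate_reflect (hM : L ≤ M) (i : ℤ) (p : TasepConfig L L × TasepConfig M M) :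
    LeftUpdate L (-i) (reflect p.1.extend) (reflect p.2.extend)
      (reflect (pairEvent i p).1.extend) (reflect (pairEvent i p).2.extend) where
  pin := by rw [reflect, extend_of_lt _ (by omega)]; rfl
  pin' := by rw [reflect, extend_of_lt _ (by omega)]; rfl
  left x hx hx' := by rw [hop_reflect, reflect, pairEvent, extend_event i p.1 (by omega) (by omega)]
  right x hx hx' := by
    rw [hop_reflect, reflect, pairEvent, extend_event i p.2 (by omega) (by omega)]
  right_pin h := by
    rcases eq_or_lt_of_le hM with e | e
    · rw [reflect, extend_of_lt _ (by omega)] at h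
      simp at h
    · rwa [reflect, pairEvent, extend_event i p.2 (by omega) (by omega), ← hop_reflect] at h

/-- At most `k` crossings of the blockage account for the state of a pair of chains. -/
def PairOrder (k : ℕ) (p : TasepConfig L L × TasepConfig M M) : Prop :=
  k ≤ L → LeftOrder L k p.1.extend p.2.extend ∧
    LeftOrder L k (reflect p.1.extend) (reflect p.2.extend)

variable {k : ℕ} {p : TasepConfig L L × TasepConfig M M}

theorem PairOrder.succ (h : PairOrder k p) : PairOrder (k + 1) p := fun hk =>
  have h' := h (by omega)
  ⟨h'.1.mono (by push_cast; omega), h'.2.mono (by push_cast; omega)⟩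

theorem PairOrder.extend_eq (h : PairOrder k p) (hL : 1 ≤ L) (hk : k ≤ L) :
    p.1.extend 0 = p.2.extend 0 ∧ p.1.extend 1 = p.2.extend 1 := by
  refine ⟨(h hk).1.apply_zero_eq hL (by omega), ?_⟩
  have := (h hk).2.apply_zero_eq hL (by omega)
  simpa [reflect] using this

theorem PairOrder.pairEvent (h : PairOrder k p) (hM : L ≤ M) {i : ℤ} (hi : i ≠ 0) :
    PairOrder k (pairEvent i p) := fun hk =>
  ⟨(h hk).1.update (leftUpdate hM i p) hi,
    (h hk).2.update (leftUpdate_reflect hM i p) (neg_ne_zero.2 hi)⟩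

/-- Agreement at the blockage is available only for `k ≤ L`. The guard in `PairOrder` makes the
claim void beyond that, so that it holds for all `k`. -/
theorem PairOrder.pairEvent_zero (h : PairOrder k p) (hL : 1 ≤ L) (hM : L ≤ M) :
    PairOrder (k + 1) (TasepConfig.pairEvent 0 p) := fun hk => by
  have h' := h (by omega)
  obtain ⟨e0, e1⟩ := h.extend_eq hL (by omega)
  have u := leftUpdate_reflect hM 0 p
  rw [neg_zero] at u
  push_cast
  exact ⟨h'.1.update_zero (leftUpdate hM 0 p) hL e0 e1,
    h'.2.update_zero u hL (by simp [reflect, e1]) (by simp [reflect, e0])⟩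

theorem pairOrder_step : PairOrder 0 (step L, step M) := fun _ =>
  ⟨LeftOrder.refl_of_forall (fun x hx => by simp [extend_step, hx])
    (fun x hx => by simp [extend_step, hx]),
   LeftOrder.refl_of_forall (fun x hx => by simp [reflect, extend_step]; omega)
    (fun x hx => by simp [reflect, extend_step]; omega)⟩

end TasepConfig

/-! ### Marginals of the coupling, and comparison of the currents. -/

open Classical in
/-- An invariant state is mapped to an invariant state by a map that commutes with the events. -/
theorem IsInvariantState.exists_map {S S' : Type*} [Fintype S] [Fintype S'] {I : Finset ℤ}
    {T : ℤ → S → S} {T' : ℤ → S' → S'} {r : ℝ} {π : S → ℝ}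
    (hπ : IsInvariantState (eventGenerator I T r) π) (φ : S → S')
    (hφ : ∀ i s, φ (T i s) = T' i (φ s)) :
    ∃ μ : S' → ℝ, IsInvariantState (eventGenerator I T' r) μ ∧
      ∀ g : S' → ℝ, ∑ t, μ t * g t = ∑ s, π s * g (φ s) := by
  let μ : S' → ℝ := fun t => ∑ s, if φ s = t then π s else 0
  have hμ : ∀ g : S' → ℝ, ∑ t, μ t * g t = ∑ s, π s * g (φ s) := fun g => by
    simp only [μ, Finset.sum_mul]
    rw [Finset.sum_comm]
    simp
  refine ⟨μ, ⟨⟨fun t => Finset.sum_nonneg fun s _ => ?_, ?_⟩, fun f => ?_⟩, hμ⟩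
  · split_ifs
    exacts [hπ.1.1 s, le_rfl]
  · have := hμ fun _ => 1
    simpa [hπ.1.2] using this
  · rw [hμ, ← hπ.2 (f ∘ φ)]
    simp only [eventGenerator, Function.comp_apply, hφ]

namespace TasepConfig

open Classical in
/-- The indicator function of the configurations in which the blockage can be crossed. -/
noncomputable def crossing {L : ℕ} (η : TasepConfig L L) : ℝ := if η.CanCross then 1 else 0

theorem existsUnique_stationary {L : ℕ} (hL : 1 ≤ L) {r : ℝ} (hr : 0 ≤ r) :
    ∃! μ : TasepConfig L L → ℝ, IsTasepStationary L L r 1 1 μ := by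
  simp only [isTasepStationary_iff hL le_rfl]
  exact (drainsTo le_rfl).existsUnique hr

theorem blockageCurrent_eq {L M : ℕ} (hL : 1 ≤ L) (hM : L ≤ M) {r : ℝ} (hr : 0 ≤ r)
    {μ : TasepConfig L L → ℝ}
    (hμ : IsInvariantState (eventGenerator (Finset.Icc (-(M : ℤ)) M) event r) μ) :
    blockageCurrent L r = r * ∑ η, μ η * crossing η := by
  have hs : IsTasepStationary L L r 1 1 μ := (isTasepStationary_iff hL hM r μ).2 hμ
  have he : tasepState L L r 1 1 = μ :=
    (existsUnique_stationary hL hr).unique (Classical.epsilon_spec ⟨μ, hs⟩) hs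
  rw [blockageCurrent, tasepCurrent, he]
  simp only [crossing, mul_ite, mul_one, mul_zero]

/-- Both projections of the invariant state of the pair are invariant, hence by uniqueness the
stationary states. The crossing indicators agree on `PairOrder L`, whose complement has probability
at most `(K * r) ^ (L + 1)`. -/
theorem exists_abs_blockageCurrent_sub_le {L M : ℕ} (hL : 1 ≤ L) (hM : L ≤ M) :
    ∃ C : ℝ, ∀ r : ℝ, 0 ≤ r →
      |blockageCurrent M r - blockageCurrent L r| ≤ C * r ^ (L + 2) := by
  classical
  obtain ⟨K, -, hK⟩ := (drainsTo_pair hM).exists_prob_bound (PairOrder (L := L) (M := M))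
    pairOrder_step (fun k p h => h.succ) (fun k i p hi h => h.pairEvent hM hi)
    (fun k p h => h.pairEvent_zero hL hM)
  refine ⟨K ^ (L + 1), fun r hr => ?_⟩
  obtain ⟨π, hπ, -⟩ := (drainsTo_pair hM).existsUnique hr
  obtain ⟨μ, hμ, hμ'⟩ := hπ.exists_map (T' := event) Prod.fst fun i p => rfl
  obtain ⟨ν, hν, hν'⟩ := hπ.exists_map (T' := event) Prod.snd fun i p => rfl
  have hdiff : |∑ p, π p * crossing p.2 - ∑ p, π p * crossing p.1| ≤ (K * r) ^ (L + 1) := by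
    refine le_trans ?_ (hK r hr π hπ L)
    rw [← Finset.sum_sub_distrib]
    refine (Finset.abs_sum_le_sum_abs _ _).trans (Finset.sum_le_sum fun p _ => ?_)
    rw [← mul_sub, abs_mul, abs_of_nonneg (hπ.1.1 p)]
    refine mul_le_mul_of_nonneg_left ?_ (hπ.1.1 p)
    by_cases h : PairOrder L p
    · obtain ⟨e0, e1⟩ := h.extend_eq hL le_rfl
      have : p.1.CanCross ↔ p.2.CanCross := by
        rw [canCross_iff hL, canCross_iff (hL.trans hM), e0, e1]
      simp [crossing, h, this]
    · rw [if_neg h, crossing, crossing]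
      split_ifs <;> simp
  rw [blockageCurrent_eq (hL.trans hM) le_rfl hr hν, blockageCurrent_eq hL hM hr hμ, hμ', hν',
    ← mul_sub, abs_mul, abs_of_nonneg hr]
  calc _ ≤ r * (K * r) ^ (L + 1) := mul_le_mul_of_nonneg_left hdiff hr
    _ = _ := by ring

theorem exists_blockageCurrent_analyticAt {L : ℕ} (hL : 1 ≤ L) :
    ∃ F : ℝ → ℝ, AnalyticAt ℝ F 0 ∧ ∀ᶠ r in 𝓝[>] (0 : ℝ), blockageCurrent L r = F r := by
  obtain ⟨F, hF, hFr⟩ := (drainsTo (L := L) le_rfl).exists_analyticAt crossing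
  refine ⟨fun r => r * F r, analyticAt_id.mul hF, ?_⟩
  filter_upwards [hFr, self_mem_nhdsWithin] with r h hr
  obtain ⟨μ, hμ, -⟩ := (drainsTo (L := L) le_rfl).existsUnique (le_of_lt hr)
  rw [blockageCurrent_eq hL le_rfl (le_of_lt hr) hμ, h μ hμ]

theorem exists_hasSum_blockageCurrent {L : ℕ} (hL : 1 ≤ L) :
    ∃ c : ℕ → ℝ, ∃ R : ℝ, 0 < R ∧ ∀ r : ℝ, 0 < r → r < R →
      HasSum (fun k : ℕ => c k * r ^ k) (blockageCurrent L r) := by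
  obtain ⟨F, ⟨p, hp⟩, hF⟩ := exists_blockageCurrent_analyticAt hL
  refine ⟨p.coeff, ?_⟩
  have h := (hasFPowerSeriesAt_iff.1 hp).filter_mono (nhdsWithin_le_nhds (s := Set.Ioi 0))
  obtain ⟨R, hR, hs⟩ := mem_nhdsGT_iff_exists_Ioo_subset.1 (h.and hF)
  refine ⟨R, hR, fun r h0 h1 => ?_⟩
  obtain ⟨h2, h3⟩ := hs ⟨h0, h1⟩
  rw [h3]
  simpa [mul_comm] using h2

end TasepConfig

/-! ### Taylor coefficients from one-sided asymptotics. -/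

theorem eq_zero_of_hasSum_of_isBigO {a : ℕ → ℝ} {f : ℝ → ℝ} {R : ℝ} {N : ℕ} (hR : 0 < R)
    (hf : ∀ r : ℝ, 0 < r → r < R → HasSum (fun k : ℕ => a k * r ^ k) (f r))
    (hO : f =O[𝓝[>] (0 : ℝ)] fun r => r ^ N) {k : ℕ} (hk : k < N) : a k = 0 := by
  set p := FormalMultilinearSeries.ofScalars ℝ a with hp
  -- Summability at the single point `R / 2` makes the terms there tend to zero, which bounds the
  -- radius below.
  have hrad : 0 < p.radius := by
    lift R to NNReal using hR.le
    have hR2 : 0 < R / 2 := half_pos (by exact_mod_cast hR)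
    refine lt_of_lt_of_le (ENNReal.coe_pos.2 hR2) (p.le_radius_of_tendsto (l := 0) ?_)
    have hR2' : ((R / 2 : NNReal) : ℝ) < R := by push_cast; linarith
    have h := (hf _ (NNReal.coe_pos.2 hR2) hR2').summable.tendsto_atTop_zero.norm
    simpa [hp, FormalMultilinearSeries.ofScalars_norm] using h
  have hps := (p.hasFPowerSeriesOnBall hrad).hasFPowerSeriesAt
  have hfp : ∀ᶠ r in 𝓝[>] (0 : ℝ), p.sum r = f r := by
    filter_upwards [Ioo_mem_nhdsGT hR] with r hr
    rw [← (hf r hr.1 hr.2).tsum_eq, FormalMultilinearSeries.sum]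
    simp [hp, mul_comm]
  have hpow : ∀ {m n : ℕ}, m ≤ n → (fun r : ℝ => r ^ n) =O[𝓝[>] (0 : ℝ)] fun r => r ^ m :=
    fun h => IsBigO.of_bound 1 (by
      filter_upwards [Ioo_mem_nhdsGT one_pos] with r hr
      rw [one_mul, norm_pow, norm_pow, Real.norm_of_nonneg hr.1.le]
      exact pow_le_pow_of_le_one hr.1.le hr.2.le h)
  induction k using Nat.strong_induction_on with
  | _ k ih =>
  -- The earlier coefficients vanish by induction, so the partial sum is its last term.
  have h1 : (fun r : ℝ => p.sum r - a k * r ^ k) =O[𝓝[>] (0 : ℝ)] fun r => r ^ (k + 1) := by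
    have h := (hps.isBigO_sub_partialSum_pow (k + 1)).mono (nhdsWithin_le_nhds (s := Set.Ioi 0))
    have he : ∀ y : ℝ, p.partialSum (k + 1) y = a k * y ^ k := fun y => by
      rw [FormalMultilinearSeries.partialSum, Finset.sum_range_succ, Finset.sum_eq_zero, zero_add]
      · simp [hp, mul_comm]
      · intro j hj
        have hj' := Finset.mem_range.1 hj
        simp [hp, ih j hj' (hj'.trans hk)]
    simp only [he, zero_add, ← norm_pow] at h
    exact h.of_norm_right
  have h2 : (fun r : ℝ => a k * r ^ k) =O[𝓝[>] (0 : ℝ)] fun r => r ^ (k + 1) := by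
    have h := (((hO.congr' (hfp.mono fun r h => h.symm) EventuallyEq.rfl)).trans
      (hpow (Nat.succ_le_of_lt hk))).sub h1
    simpa using h
  obtain ⟨C, hC⟩ := h2.bound
  have h3 : ∀ᶠ r in 𝓝[>] (0 : ℝ), |a k| ≤ C * r := by
    filter_upwards [hC, self_mem_nhdsWithin] with r h hr
    have hr' : (0 : ℝ) < r := hr
    rw [norm_mul, norm_pow, norm_pow, Real.norm_eq_abs, Real.norm_of_nonneg hr'.le, pow_succ,
      mul_comm (r ^ k), ← mul_assoc] at h
    exact le_of_mul_le_mul_right h (pow_pos hr' k)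
  have h4 : Tendsto (fun r : ℝ => C * r) (𝓝[>] 0) (𝓝 0) := by
    have : Tendsto (fun r : ℝ => C * r) (𝓝 0) (𝓝 (C * 0)) := (continuous_const_mul C).tendsto 0
    rw [mul_zero] at this
    exact this.mono_left nhdsWithin_le_nhds
  exact abs_nonpos_iff.1 (ge_of_tendsto h4 h3)

theorem theorem1 :
    -- the stationary state exists and is unique, so that the current is well defined
    (∀ L : ℕ, 1 ≤ L → ∀ r : ℝ, 0 < r →
      ∃! μ : TasepConfig L L → ℝ, IsTasepStationary L L r 1 1 μ) ∧
    -- comparison of the currents of two systems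
    (∀ L₁ L₂ : ℕ, 1 ≤ L₁ → L₁ ≤ L₂ →
      (fun r : ℝ => blockageCurrent L₂ r - blockageCurrent L₁ r)
        =O[𝓝[>] (0 : ℝ)] (fun r : ℝ => r ^ (L₁ + 2))) ∧
    -- the currents have Taylor expansions at `r = 0`, with coefficients that stabilise
    (∃ c : ℕ → ℕ → ℝ,
      (∀ L : ℕ, 1 ≤ L → ∃ R : ℝ, 0 < R ∧ ∀ r : ℝ, 0 < r → r < R →
        HasSum (fun k : ℕ => c L k * r ^ k) (blockageCurrent L r)) ∧
      (∀ L₁ L₂ : ℕ, 1 ≤ L₁ → L₁ ≤ L₂ → ∀ k : ℕ, k ≤ L₁ + 1 → c L₂ k = c L₁ k)) := by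
  have hbig : ∀ L₁ L₂ : ℕ, 1 ≤ L₁ → L₁ ≤ L₂ →
      (fun r : ℝ => blockageCurrent L₂ r - blockageCurrent L₁ r)
        =O[𝓝[>] (0 : ℝ)] (fun r : ℝ => r ^ (L₁ + 2)) := fun L₁ L₂ h1 h12 => by
    obtain ⟨C, hC⟩ := TasepConfig.exists_abs_blockageCurrent_sub_le h1 h12
    refine IsBigO.of_bound C ?_
    filter_upwards [self_mem_nhdsWithin] with r hr
    have hr' : 0 ≤ r := le_of_lt hr
    rw [Real.norm_eq_abs, Real.norm_of_nonneg (pow_nonneg hr' _)]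
    exact hC r hr'
  refine ⟨fun L hL r hr => TasepConfig.existsUnique_stationary hL hr.le, hbig, ?_⟩
  -- The condition `1 ≤ L` stands inside the existential so that the chosen coefficients depend on
  -- `L` alone; those for `L = 0` are arbitrary.
  have hex : ∀ L : ℕ, ∃ c : ℕ → ℝ, 1 ≤ L → ∃ R : ℝ, 0 < R ∧ ∀ r : ℝ, 0 < r → r < R →
      HasSum (fun k : ℕ => c k * r ^ k) (blockageCurrent L r) := fun L => by
    by_cases hL : 1 ≤ L
    · obtain ⟨c, hc⟩ := TasepConfig.exists_hasSum_blockageCurrent hL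
      exact ⟨c, fun _ => hc⟩
    · exact ⟨0, fun h => absurd h hL⟩
  choose c hc using hex
  refine ⟨c, hc, fun L₁ L₂ h1 h12 k hk => ?_⟩
  obtain ⟨R₁, hR₁, hs₁⟩ := hc L₁ h1
  obtain ⟨R₂, hR₂, hs₂⟩ := hc L₂ (h1.trans h12)
  refine sub_eq_zero.1 (eq_zero_of_hasSum_of_isBigO (a := fun k => c L₂ k - c L₁ k)
    (lt_min hR₁ hR₂) (fun r h0 hr => ?_) (hbig L₁ L₂ h1 h12) (Nat.lt_succ_of_le hk))
  simp only [sub_mul]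
  exact (hs₂ r h0 (hr.trans_le (min_le_right _ _))).sub (hs₁ r h0 (hr.trans_le (min_le_left _ _)))
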